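/- Let $K$ be a field of characteristic $0$ and $\overline K$ an algebraic closure of $K$. The field $\overline K\langle\langle X\rangle\rangle$ of Puiseux series consists of the formal series $\phi(X)=\sum_{t\ge t_0}a_tX^{t/d}$ with $t_0\in\mathbb Z$, $d\in\mathbb Z_{>0}$ and $a_t\in\overline K$; the valuation of a nonzero $\phi$ is the least exponent that occurs in $\phi$ with a nonzero coefficient. For a nonzero polynomial $h\in K[X,Y]$ and an irreducible $g\in K[X,Y]$, $\operatorname{mult}_g(h)$ denotes the largest integer $\mu\ge 0$ such that $g^\mu$ divides $h$, and $\operatorname{mult}_g(0)=\infty$. Let $v\in\mathbb Q$ and $d_X,d_Y\in\mathbb N$, put $\gamma(\ell)=4d_Xd_Y(\ell-1)^2$ for $\ell\ge 1$, and let $f=f_1+f_2\in K[X,Y]$ with $$f_1=\sum_{j=1}^{\ell}c_jX^{\alpha_j}Y^{\beta_j},\qquad f_2=\sum_{j=\ell+1}^{k}c_jX^{\alpha_j}Y^{\beta_j},$$ where $c_j\in K$, $\alpha_j,\beta_j\in\mathbb N$, and $\alpha_j+v\beta_j\le\alpha_{j+1}+v\beta_{j+1}$ for $1\le j<k$ (zero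 coefficients and repeated exponent pairs are allowed). Suppose that $\ell$ is the smallest index with $1\le\ell<k$ such that $$\alpha_{\ell+1}+v\beta_{\ell+1}>\alpha_1+v\beta_1+\gamma(\ell).$$ Then, for every irreducible polynomial $g\in K[X,Y]$ with $\deg_X(g)\le d_X$ and $\deg_Y(g)\le d_Y$ for which there is a nonzero Puiseux series $\phi$ over $\overline K$ of valuation $v$ with $g(X,\phi(X))=0$, $$\operatorname{mult}_g(f)=\min\bigl(\operatorname{mult}_g(f_1),\operatorname{mult}_g(f_2)\bigr).$$ -/

import Mathlib

namespace LacunaryGap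

section Puiseux

variable (L : Type*) [Field L]

/-- The order-preserving additive map `t ↦ t / d` from `ℤ` to `ℚ` induces an embedding of the Laurent
series over `L` into the Hahn series with rational exponents: it replaces `X` by `X ^ (1 / d)`. -/
noncomputable def ramify (d : ℕ) (hd : 0 < d) : HahnSeries ℤ L →+* HahnSeries ℚ L :=
  HahnSeries.embDomainRingHom
    { toFun := fun t : ℤ => (t : ℚ) / d
      map_zero' := by simp
      map_add' := fun a b => by push_cast; ring }
    (fun a b h => by
      have hd' : (d : ℚ) ≠ 0 := by exact_mod_cast hd.ne'
      have h' : (a : ℚ) / d = (b : ℚ) / d := h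
      exact_mod_cast (div_left_inj' hd').1 h')
    (fun a b => by
      have hd' : (0 : ℚ) < d := by exact_mod_cast hd
      change (a : ℚ) / d ≤ (b : ℚ) / d ↔ a ≤ b
      rw [div_le_div_iff_of_pos_right hd', Int.cast_le])

variable {L}

/-- A series with well-ordered rational exponents is a Puiseux series when its exponents have a
common denominator `d`. (A well-ordered subset of `(1 / d) ℤ` is the same thing as a subset of
`(1 / d) ℤ` that is bounded below, so these are exactly the series `∑_{t ≥ t₀} f_t X ^ (t / d)`.) -/
def IsPuiseux (φ : HahnSeries ℚ L) : Prop :=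
  ∃ d : ℕ, 0 < d ∧ ∀ q ∈ φ.support, ∃ t : ℤ, q = (t : ℚ) / d

theorem isPuiseux_ramify (d : ℕ) (hd : 0 < d) (ψ : HahnSeries ℤ L) :
    IsPuiseux (ramify L d hd ψ) := by
  refine ⟨d, hd, fun q hq => ?_⟩
  obtain ⟨t, -, ht⟩ := HahnSeries.support_embDomain_subset hq
  exact ⟨t, ht.symm⟩

theorem IsPuiseux.exists_ramify {φ : HahnSeries ℚ L} (h : IsPuiseux φ) :
    ∃ (d : ℕ) (hd : 0 < d) (ψ : HahnSeries ℤ L), ramify L d hd ψ = φ := by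
  obtain ⟨d, hd, h⟩ := h
  have hd' : (0 : ℚ) < d := by exact_mod_cast hd
  have hpwo : (Function.support fun t : ℤ => φ.coeff ((t : ℚ) / d)).IsPWO := by
    intro u
    obtain ⟨m, n, hmn, hle⟩ := φ.isPWO_support (fun n => ⟨((u n : ℤ) : ℚ) / d, (u n).2⟩)
    refine ⟨m, n, hmn, ?_⟩
    have hle' : ((u m : ℤ) : ℚ) / d ≤ ((u n : ℤ) : ℚ) / d := hle
    change (u m : ℤ) ≤ (u n : ℤ)
    exact_mod_cast (div_le_div_iff_of_pos_right hd').1 hle'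
  refine ⟨d, hd, ⟨fun t => φ.coeff ((t : ℚ) / d), hpwo⟩, ?_⟩
  ext q
  by_cases hq : ∃ t : ℤ, q = (t : ℚ) / d
  · obtain ⟨t, rfl⟩ := hq
    exact HahnSeries.embDomain_coeff (a := t)
  · have h1 : φ.coeff q = 0 := by
      by_contra hne
      exact hq (h q hne)
    rw [h1]
    refine HahnSeries.embDomain_of_notMem_range ?_
    rintro ⟨t, ht⟩
    exact hq ⟨t, ht.symm⟩

theorem IsPuiseux.add {φ ψ : HahnSeries ℚ L} (hφ : IsPuiseux φ) (hψ : IsPuiseux ψ) :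
    IsPuiseux (φ + ψ) := by
  obtain ⟨d, hd, h⟩ := hφ
  obtain ⟨e, he, h'⟩ := hψ
  have hd' : (d : ℚ) ≠ 0 := by exact_mod_cast hd.ne'
  have he' : (e : ℚ) ≠ 0 := by exact_mod_cast he.ne'
  refine ⟨d * e, Nat.mul_pos hd he, fun q hq => ?_⟩
  rcases HahnSeries.support_add_subset _ _ hq with hq | hq
  · obtain ⟨t, rfl⟩ := h q hq
    exact ⟨t * e, by push_cast; field_simp⟩
  · obtain ⟨t, rfl⟩ := h' q hq
    exact ⟨t * d, by push_cast; field_simp⟩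

theorem IsPuiseux.mul {φ ψ : HahnSeries ℚ L} (hφ : IsPuiseux φ) (hψ : IsPuiseux ψ) :
    IsPuiseux (φ * ψ) := by
  obtain ⟨d, hd, h⟩ := hφ
  obtain ⟨e, he, h'⟩ := hψ
  have hd' : (d : ℚ) ≠ 0 := by exact_mod_cast hd.ne'
  have he' : (e : ℚ) ≠ 0 := by exact_mod_cast he.ne'
  refine ⟨d * e, Nat.mul_pos hd he, fun q hq => ?_⟩
  obtain ⟨a, ha, b, hb, rfl⟩ := HahnSeries.support_mul_subset hq
  obtain ⟨s, rfl⟩ := h a ha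
  obtain ⟨t, rfl⟩ := h' b hb
  exact ⟨s * e + t * d, by push_cast; field_simp⟩

theorem IsPuiseux.inv {φ : HahnSeries ℚ L} (hφ : IsPuiseux φ) : IsPuiseux φ⁻¹ := by
  obtain ⟨d, hd, ψ, rfl⟩ := hφ.exists_ramify
  rw [← map_inv₀]
  exact isPuiseux_ramify d hd ψ⁻¹

theorem isPuiseux_single (n : ℤ) (c : L) : IsPuiseux (HahnSeries.single (n : ℚ) c) :=
  ⟨1, one_pos, fun q hq => ⟨n, by simpa using HahnSeries.eq_of_mem_support_single hq⟩⟩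

theorem isPuiseux_C (c : L) : IsPuiseux (HahnSeries.C c : HahnSeries ℚ L) := by
  have h := isPuiseux_single 0 c
  rw [Int.cast_zero] at h
  exact h

variable (L)

/-- The field of Puiseux series in one variable `X` over `L`. -/
noncomputable def PuiseuxSeries : Subfield (HahnSeries ℚ L) where
  carrier := {φ | IsPuiseux φ}
  mul_mem' := IsPuiseux.mul
  add_mem' := IsPuiseux.add
  one_mem' := isPuiseux_C 1
  zero_mem' := ⟨1, one_pos, fun q hq => by simp at hq⟩
  neg_mem' := fun {φ} h => by
    obtain ⟨d, hd, h⟩ := h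
    exact ⟨d, hd, fun q hq => h q (by simpa using hq)⟩
  inv_mem' _ := IsPuiseux.inv

/-- The constant series. -/
noncomputable def puiseuxC : L →+* PuiseuxSeries L :=
  (HahnSeries.C : L →+* HahnSeries ℚ L).codRestrict (PuiseuxSeries L) isPuiseux_C

/-- The series `X`. -/
noncomputable def puiseuxX : PuiseuxSeries L :=
  ⟨HahnSeries.single 1 1, by
    have h := isPuiseux_single 1 (1 : L)
    rw [Int.cast_one] at h
    exact h⟩

variable {L}

/-- The valuation of a nonzero Puiseux series: the least exponent with a nonzero coefficient.
(It has the value `0` on the zero series, and is used for nonzero series only.) -/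
noncomputable def puiseuxVal (φ : PuiseuxSeries L) : ℚ :=
  (φ : HahnSeries ℚ L).order

end Puiseux

section Polynomials

variable {K : Type*} [Field K]

/-- `g ∈ K[X, Y]` has a root of valuation `v` in the field of Puiseux series over `L`: there is a
nonzero Puiseux series `φ` of valuation `v` with `g(X, φ(X)) = 0`. The variables `X` and `Y` are
those of index `0` and `1`, and `L` is meant to be an algebraic closure of `K`. -/
def HasPuiseuxRoot (L : Type*) [Field L] [Algebra K L] (g : MvPolynomial (Fin 2) K) (v : ℚ) : Prop :=
  ∃ φ : PuiseuxSeries L, φ ≠ 0 ∧ puiseuxVal φ = v ∧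
    MvPolynomial.eval₂ ((puiseuxC L).comp (algebraMap K L)) ![puiseuxX L, φ] g = 0

/-- `g` has bidegree at most `(dX, dY)`. -/
def BidegreeLE (g : MvPolynomial (Fin 2) K) (dX dY : ℕ) : Prop :=
  g.degreeOf 0 ≤ dX ∧ g.degreeOf 1 ≤ dY

/-- The polynomial `∑_{m ≤ j ≤ n} c_j X ^ α_j Y ^ β_j`. -/
noncomputable def termSum (c : ℕ → K) (α β : ℕ → ℕ) (m n : ℕ) : MvPolynomial (Fin 2) K :=
  ∑ j ∈ Finset.Icc m n,
    MvPolynomial.C (c j) * MvPolynomial.X 0 ^ α j * MvPolynomial.X 1 ^ β j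

/-- The gap `γ(ℓ) = 4 dX dY (ℓ - 1) ^ 2`. -/
def gap (dX dY ℓ : ℕ) : ℚ := 4 * dX * dY * ((ℓ : ℚ) - 1) ^ 2

end Polynomials

end LacunaryGap

/-! Let φ be a root of g of valuation v. As g is irreducible, g ∣ p exactly when p(X, φ) = 0
(`evalSeries_eq_zero_iff`). If g ∣ f, then f₁(X, φ) = -f₂(X, φ), and the right side has valuation
above α₁ + vβ₁ + γ(ℓ). So it suffices that f₁(X, φ), when nonzero, has at most this valuation
(`orderTop_evalSeries_termSum_le`).

The bound comes from a Wronskian (`orderTop_sum_monomials_le`). Take n ≥ 2 monomials in X and φ,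
independent over L, and the derivation D = (Y∂_Y g)(X, φ) · X d/dX. It is induced by a derivation of
K[X, Y], so the Wronskian is the product of the monomials times some P(X, φ), where P has bidegree
at most (N dX, N dY) and N = n(n-1)/2. It is nonzero, and eliminating Y between g and P bounds the
valuation of P(X, φ) by (2N+1) dX dY. Replacing one column by the derivatives of a linear
combination F only multiplies the determinant by a nonzero constant, and a lower bound from the
entries loses N dX dY. Hence F exceeds the replaced monomial in valuation by at most (3N+1) dX dY ≤
γ(n).

For higher multiplicities, Y∂_Y changes coefficients but not exponents, so the gap persists and
induction on the power applies (`pow_dvd_left_of_pow_dvd_add`). -/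

namespace LacunaryGap

/-! ### Wronskians, determinants and resultants -/

section General

/-- If the Wronskian of a finite family of elements of a differential field vanishes, then the
family is linearly dependent over the constants. -/
theorem exists_const_dependence_of_wronskian_eq_zero {F : Type*} [Field F] (D : F →+ F)
    (hD : ∀ x y, D (x * y) = x * D y + y * D x) (n : ℕ) (f : Fin n → F)
    (h : (Matrix.of fun i j : Fin n => D^[i] (f j)).det = 0) :
    ∃ w : Fin n → F, w ≠ 0 ∧ (∀ j, D (w j) = 0) ∧ ∑ j, w j * f j = 0 := by
  have hD1 : D 1 = 0 := by simpa using hD 1 1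
  induction n with
  | zero => simp at h
  | succ n ih =>
    by_cases h0 : (Matrix.of fun i j : Fin n => D^[i] (f j.castSucc)).det = 0
    · obtain ⟨w, hw, hDw, hs⟩ := ih _ h0
      refine ⟨Fin.snoc w 0, fun h => hw ?_, fun j => ?_, ?_⟩
      · funext j
        simpa using congrFun h j.castSucc
      · refine Fin.lastCases ?_ (fun j => ?_) j
        · simp
        · simpa using hDw j
      · simpa [Fin.sum_univ_castSucc] using hs
    · obtain ⟨w, hw, hs⟩ := Matrix.exists_mulVec_eq_zero_iff.2 h
      have hs' : ∀ i : ℕ, i < n + 1 → ∑ j, w j * D^[i] (f j) = 0 := fun i hi => by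
        have := congrFun hs ⟨i, hi⟩
        simpa [Matrix.mulVec, dotProduct, mul_comm] using this
      have hlast : w (Fin.last n) ≠ 0 := fun hl => hw <| by
        have hz : (fun j : Fin n => w j.castSucc) = 0 := by
          by_contra hne
          refine h0 (Matrix.exists_mulVec_eq_zero_iff.1 ⟨_, hne, ?_⟩)
          funext i
          have := hs' i (by omega)
          rw [Fin.sum_univ_castSucc, hl] at this
          simpa [Matrix.mulVec, dotProduct, mul_comm] using this
        funext j
        refine Fin.lastCases ?_ (fun j => ?_) j
        · simpa using hl
        · exact congrFun hz j
      set u : Fin (n + 1) → F := fun j => w j / w (Fin.last n) with hu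
      have hus : ∀ i : ℕ, i < n + 1 → ∑ j, u j * D^[i] (f j) = 0 := fun i hi => by
        simp only [hu, div_mul_eq_mul_div, ← Finset.sum_div, hs' i hi, zero_div]
      have hul : u (Fin.last n) = 1 := div_self hlast
      -- Differentiating relation `i` and subtracting relation `i + 1` leaves a homogeneous system
      -- for the `D (u j)`. Its last unknown is `D 1 = 0`, and the remaining square matrix is
      -- nonsingular by `h0`.
      have hDz : (fun j : Fin n => D (u j.castSucc)) = 0 := by
        by_contra hne
        refine h0 (Matrix.exists_mulVec_eq_zero_iff.1 ⟨_, hne, ?_⟩)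
        funext i
        have h1 := congrArg D (hus i (by omega))
        have h2 := hus (i + 1) (by omega)
        simp only [map_sum, hD, Finset.sum_add_distrib, map_zero,
          ← Function.iterate_succ_apply' D] at h1
        rw [h2, zero_add, Fin.sum_univ_castSucc, hul] at h1
        simpa [Matrix.mulVec, dotProduct, hD1] using h1
      refine ⟨u, fun h => ?_, fun j => ?_, by simpa using hus 0 (by omega)⟩
      · simpa [hul] using congrFun h (Fin.last n)
      · refine Fin.lastCases ?_ (fun j => ?_) j
        · simp [hul, hD1]
        · exact congrFun hDz j

theorem le_addValuation_prod {R Γ ι : Type*} [CommRing R]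
    [LinearOrderedAddCommMonoidWithTop Γ] (v : AddValuation R (Γ)) (s : Finset ι)
    (f : ι → R) (a : ι → Γ) (h : ∀ i ∈ s, a i ≤ v (f i)) :
    ∑ i ∈ s, a i ≤ v (∏ i ∈ s, f i) := by
  classical
  induction s using Finset.induction_on with
  | empty => simp
  | insert i s hi ih =>
    rw [Finset.sum_insert hi, Finset.prod_insert hi, v.map_mul]
    exact add_le_add (h i (by simp)) (ih fun j hj => h j (by simp [hj]))

/-- Each product in the permutation expansion meets every row and every column once, so it collects
all the row and column weights. -/
theorem le_addValuation_det {R Γ ι : Type*} [CommRing R]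
    [LinearOrderedAddCommMonoidWithTop Γ] [Fintype ι] [DecidableEq ι]
    (v : AddValuation R (Γ)) (A : Matrix ι ι R) (r c : ι → Γ)
    (h : ∀ i j, r i + c j ≤ v (A i j)) : ∑ i, r i + ∑ j, c j ≤ v A.det := by
  rw [Matrix.det_apply]
  refine v.map_le_sum fun σ _ => ?_
  have h1 : ∑ i, r i + ∑ j, c j ≤ v (∏ i, A (σ i) i) := by
    rw [← Equiv.sum_comp σ r, ← Finset.sum_add_distrib]
    exact le_addValuation_prod v _ _ _ fun i _ => h _ _
  rcases Int.units_eq_one_or (Equiv.Perm.sign σ) with hσ | hσ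
  · simpa [hσ] using h1
  · simpa [hσ, AddValuation.map_neg] using h1

-- In the Sylvester matrix, `m` columns hold coefficients of `q` and `n` columns those of `p`; each
-- product in the expansion takes one entry per column.
open Polynomial in
theorem natDegree_resultant_le {R : Type*} [CommRing R] (p q : R[X][X]) (m n a b : ℕ)
    (hp : ∀ i, (p.coeff i).natDegree ≤ a) (hq : ∀ i, (q.coeff i).natDegree ≤ b) :
    (resultant p q m n).natDegree ≤ m * b + n * a := by
  rw [resultant, Matrix.det_apply]
  refine natDegree_sum_le_of_forall_le _ _ fun σ _ => ?_
  have h1 : (∏ i, sylvester p q m n (σ i) i).natDegree ≤ m * b + n * a := by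
    refine (natDegree_prod_le _ _).trans ?_
    rw [Fin.sum_univ_add]
    refine add_le_add ?_ ?_
    · refine (Finset.sum_le_card_nsmul _ _ b fun i _ => ?_).trans (by simp)
      simp only [sylvester, Matrix.of_apply, Fin.addCases_left]
      split_ifs
      · exact hq _
      · simp
    · refine (Finset.sum_le_card_nsmul _ _ a fun i _ => ?_).trans (by simp)
      simp only [sylvester, Matrix.of_apply, Fin.addCases_right]
      split_ifs
      · exact hp _
      · simp
  rcases Int.units_eq_one_or (Equiv.Perm.sign σ) with hσ | hσ
  · simpa [hσ] using h1
  · simpa [hσ] using h1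

-- By Gauss's lemma, irreducibility and non-divisibility pass to the fraction field, where they give
-- coprimality.
open Polynomial in
theorem resultant_ne_zero_of_irreducible {R : Type*} [CommRing R] [IsDomain R]
    [NormalizedGCDMonoid R] {p q : R[X]} (hp : Irreducible p) (hd : 0 < p.natDegree)
    (hpq : ¬ p ∣ q) : resultant p q ≠ 0 := by
  have hprim : p.IsPrimitive := hp.isPrimitive hd.ne'
  have hinj : Function.Injective (algebraMap R (FractionRing R)) := IsFractionRing.injective _ _
  have hirr := (hprim.irreducible_iff_irreducible_map_fraction_map (K := FractionRing R)).1 hp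
  have hcop : IsCoprime (p.map (algebraMap R (FractionRing R)))
      (q.map (algebraMap R (FractionRing R))) :=
    hirr.coprime_iff_not_dvd.2 fun h => hpq (hprim.dvd_of_fraction_map_dvd_fraction_map h)
  have h1 := resultant_ne_zero _ _ hcop
  rw [natDegree_map_eq_of_injective hinj, natDegree_map_eq_of_injective hinj,
    resultant_map_map] at h1
  exact fun h => h1 (by rw [h, map_zero])

/-- Every linear combination is a linear combination with nonzero coefficients of a linearly
independent subfamily. -/
theorem exists_linearIndepOn_sum_eq {F V ι : Type*} [Field F] [AddCommGroup V] [Module F V]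
    (s : Finset ι) (c : ι → F) (m : ι → V) :
    ∃ (t : Finset ι) (b : ι → F), t ⊆ s ∧ (∀ j ∈ t, b j ≠ 0) ∧ LinearIndepOn F m (t : Set ι) ∧
      ∑ j ∈ t, b j • m j = ∑ j ∈ s, c j • m j := by
  classical
  obtain ⟨u, hus, -, hspan, hind⟩ := exists_linearIndepOn_extension (K := F) (v := m)
    (linearIndepOn_empty F m) (Set.empty_subset (s : Set ι))
  lift u to Finset ι using s.finite_toSet.subset hus
  have hmem : ∑ j ∈ s, c j • m j ∈ Submodule.span F (m '' (u : Set ι)) :=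
    Submodule.sum_mem _ fun j hj => Submodule.smul_mem _ _ (hspan ⟨j, hj, rfl⟩)
  obtain ⟨b, hb⟩ := (Submodule.mem_span_image_finset_iff_exists_fun' F).1 hmem
  refine ⟨u.filter fun j => b j ≠ 0, b, ?_, fun j hj => (Finset.mem_filter.1 hj).2, ?_, ?_⟩
  · exact (Finset.filter_subset _ _).trans (by exact_mod_cast hus)
  · exact hind.mono (by exact_mod_cast Finset.filter_subset _ _)
  · rw [← hb]
    refine Finset.sum_filter_of_ne fun j _ h hz => h (by rw [hz, zero_smul])

end General
-- Elimination of Y, and derivations of K[X, Y]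
section Bivariate

variable {K : Type*} [Field K]

open Polynomial.Bivariate in
theorem coeff_coeff_equivMvPolynomial_symm (p : MvPolynomial (Fin 2) K) (i j : ℕ) :
    (((equivMvPolynomial K).symm p).coeff i).coeff j =
      p.coeff (Finsupp.single 0 j + Finsupp.single 1 i) := by
  induction p using MvPolynomial.induction_on' with
  | add p q hp hq => simp [hp, hq]
  | monomial m a =>
    have h : (MvPolynomial.monomial m a : MvPolynomial (Fin 2) K) =
        MvPolynomial.C a * MvPolynomial.X 0 ^ m 0 * MvPolynomial.X 1 ^ m 1 := by
      rw [MvPolynomial.monomial_eq, Finsupp.prod_fintype _ _ (by simp), Fin.prod_univ_two, mul_assoc]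
    have h' : m = Finsupp.single 0 j + Finsupp.single 1 i ↔ m 0 = j ∧ m 1 = i := by
      constructor
      · rintro rfl
        simp
      · rintro ⟨rfl, rfl⟩
        ext k
        fin_cases k <;> simp
    rw [MvPolynomial.coeff_monomial, h]
    simp only [map_mul, map_pow, equivMvPolynomial_symm_C, equivMvPolynomial_symm_X_0,
      equivMvPolynomial_symm_X_1, Polynomial.coeff_mul_X_pow', h']
    rw [← Polynomial.C_pow, ← Polynomial.C_mul]
    by_cases h1 : m 1 ≤ i
    · rw [if_pos h1, Polynomial.coeff_C]
      by_cases h2 : i - m 1 = 0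
      · rw [if_pos h2, Polynomial.coeff_C_mul_X_pow]
        exact if_congr (by omega) rfl rfl
      · rw [if_neg h2, if_neg (by omega), Polynomial.coeff_zero]
    · rw [if_neg h1, if_neg (by omega), Polynomial.coeff_zero]

open Polynomial.Bivariate in
theorem natDegree_coeff_equivMvPolynomial_symm_le (p : MvPolynomial (Fin 2) K) (i : ℕ) :
    (((equivMvPolynomial K).symm p).coeff i).natDegree ≤ p.degreeOf 0 := by
  refine Polynomial.natDegree_le_iff_coeff_eq_zero.2 fun j hj => ?_
  rw [coeff_coeff_equivMvPolynomial_symm]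
  by_contra h
  have := MvPolynomial.degreeOf_le_iff.1 (le_refl (p.degreeOf 0)) _ (MvPolynomial.mem_support_iff.2 h)
  simp at this
  omega

open Polynomial.Bivariate in
theorem natDegree_equivMvPolynomial_symm (p : MvPolynomial (Fin 2) K) :
    ((equivMvPolynomial K).symm p).natDegree = p.degreeOf 1 := by
  refine le_antisymm (Polynomial.natDegree_le_iff_coeff_eq_zero.2 fun i hi => ?_)
    (MvPolynomial.degreeOf_le_iff.2 fun m hm => Polynomial.le_natDegree_of_ne_zero fun h => ?_)
  · ext j
    rw [coeff_coeff_equivMvPolynomial_symm, Polynomial.coeff_zero]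
    by_contra h
    have := MvPolynomial.degreeOf_le_iff.1 (le_refl (p.degreeOf 1)) _
      (MvPolynomial.mem_support_iff.2 h)
    simp at this
    omega
  · have h1 := coeff_coeff_equivMvPolynomial_symm p (m 1) (m 0)
    rw [h, Polynomial.coeff_zero] at h1
    refine MvPolynomial.mem_support_iff.1 hm (Eq.trans (congrArg p.coeff ?_) h1.symm)
    ext k
    fin_cases k <;> simp

open Polynomial.Bivariate in
/-- Elimination of the variable `X 1` from an irreducible polynomial `g` and a polynomial `p` that
is not divisible by `g`. -/
theorem exists_elimination {g p : MvPolynomial (Fin 2) K} (hg : Irreducible g)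
    (hd : 0 < g.degreeOf 1) (hp : ¬ g ∣ p) :
    ∃ (A B : MvPolynomial (Fin 2) K) (R : Polynomial K), R ≠ 0 ∧
      R.natDegree ≤ g.degreeOf 1 * p.degreeOf 0 + p.degreeOf 1 * g.degreeOf 0 ∧
      A.degreeOf 1 < g.degreeOf 1 ∧ g * B + p * A = R.aeval (MvPolynomial.X 0) := by
  classical
  let _ : NormalizedGCDMonoid (Polynomial K) := Nonempty.some inferInstance
  set e := equivMvPolynomial K
  have hG : Irreducible (e.symm g) := (MulEquiv.irreducible_iff e.symm).2 hg
  have hdG : 0 < (e.symm g).natDegree := by rwa [natDegree_equivMvPolynomial_symm]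
  have hGP : ¬ e.symm g ∣ e.symm p := fun h => hp ((map_dvd_iff e.symm).1 h)
  -- The Bézout identity of the resultant in Y. The degree bound on `A` later limits how negative
  -- the valuation of A(X, φ) can be.
  obtain ⟨B, A, -, hA, h⟩ := Polynomial.exists_mul_add_mul_eq_C_resultant (e.symm g) (e.symm p)
    le_rfl le_rfl (Or.inl hdG.ne')
  refine ⟨e A, e B, _, resultant_ne_zero_of_irreducible hG hdG hGP, ?_, ?_, ?_⟩
  · rw [← natDegree_equivMvPolynomial_symm, ← natDegree_equivMvPolynomial_symm]
    exact natDegree_resultant_le _ _ _ _ _ _ (natDegree_coeff_equivMvPolynomial_symm_le _)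
      (natDegree_coeff_equivMvPolynomial_symm_le _)
  · rw [← natDegree_equivMvPolynomial_symm, ← natDegree_equivMvPolynomial_symm, e.symm_apply_apply]
    by_cases hA0 : A = 0
    · simpa [hA0] using hdG
    · exact (Polynomial.natDegree_lt_iff_degree_lt hA0).2 hA
  · have h1 := congrArg e h
    simp only [map_add, map_mul, e.apply_symm_apply] at h1
    rw [h1]
    generalize Polynomial.resultant (e.symm g) (e.symm p) = R
    induction R using Polynomial.induction_on' with
    | add p q hp hq => simp [hp, hq]
    | monomial n a =>
      rw [← Polynomial.C_mul_X_pow_eq_monomial]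
      simp [e, MvPolynomial.algebraMap_eq]

/-- The Euler derivation `X_i ∂/∂X_i`. -/
noncomputable def euler (K : Type*) [Field K] (i : Fin 2) :
    Derivation K (MvPolynomial (Fin 2) K) (MvPolynomial (Fin 2) K) :=
  (MvPolynomial.X i : MvPolynomial (Fin 2) K) • MvPolynomial.pderiv i

theorem euler_apply (i : Fin 2) (p : MvPolynomial (Fin 2) K) :
    euler K i p = MvPolynomial.X i * MvPolynomial.pderiv i p := rfl

theorem coeff_euler (i : Fin 2) (p : MvPolynomial (Fin 2) K) (m : Fin 2 →₀ ℕ) :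
    (euler K i p).coeff m = m i * p.coeff m := by
  classical
  induction p using MvPolynomial.induction_on' with
  | add p q hp hq => simp [hp, hq, mul_add]
  | monomial s a =>
    have h : euler K i (MvPolynomial.monomial s a) = MvPolynomial.monomial s (s i * a) := by
      rw [euler_apply, MvPolynomial.pderiv_monomial, MvPolynomial.X, MvPolynomial.monomial_mul]
      by_cases hs : s i = 0
      · simp [hs]
      · rw [add_tsub_cancel_of_le (Finsupp.single_le_iff.2 (by omega)), one_mul, mul_comm]
    rw [h, MvPolynomial.coeff_monomial, MvPolynomial.coeff_monomial]
    split_ifs with hsm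
    · rw [hsm]
    · rw [mul_zero]

theorem degreeOf_euler_le (i j : Fin 2) (p : MvPolynomial (Fin 2) K) :
    (euler K i p).degreeOf j ≤ p.degreeOf j := by
  refine MvPolynomial.degreeOf_le_iff.2 fun m hm =>
    MvPolynomial.degreeOf_le_iff.1 le_rfl m (MvPolynomial.mem_support_iff.2 fun h => ?_)
  exact MvPolynomial.mem_support_iff.1 hm (by rw [coeff_euler, h, mul_zero])

/-- As `g` is prime, it would divide ∂_Y g, which in characteristic 0 is nonzero and of smaller
Y-degree. -/
theorem not_dvd_euler [CharZero K] {g : MvPolynomial (Fin 2) K} (hg : Irreducible g)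
    (hd : 0 < g.degreeOf 1) (hX : ¬ g ∣ MvPolynomial.X 1) : ¬ g ∣ euler K 1 g := by
  intro h
  rcases hg.prime.dvd_or_dvd h with h | h
  · exact hX h
  · have h0 : MvPolynomial.pderiv 1 g ≠ 0 := fun h0 => by
      obtain ⟨m, hm, hmd⟩ : ∃ m ∈ g.support, g.degreeOf 1 = m 1 := by
        rw [MvPolynomial.degreeOf_eq_sup]
        exact Finset.exists_mem_eq_sup _ (MvPolynomial.support_nonempty.2 hg.ne_zero) _
      have h1 := coeff_euler 1 g m
      rw [euler_apply, h0, mul_zero, MvPolynomial.coeff_zero] at h1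
      rcases mul_eq_zero.1 h1.symm with h1 | h1
      · have : m 1 = 0 := by exact_mod_cast h1
        omega
      · exact MvPolynomial.mem_support_iff.1 hm h1
    obtain ⟨q, hq⟩ := h
    change MvPolynomial.pderiv 1 g = g * q at hq
    have hq0 : q ≠ 0 := fun h => h0 (by rw [hq, h, mul_zero])
    have h1 : (MvPolynomial.pderiv 1 g).degreeOf 1 = g.degreeOf 1 + q.degreeOf 1 := by
      rw [hq, MvPolynomial.degreeOf_mul_eq hg.ne_zero hq0]
    have h2 := degreeOf_euler_le 1 1 g
    rw [euler_apply, mul_comm] at h2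
    rw [(MvPolynomial.degreeOf_mul_X_eq_degreeOf_add_one_iff 1 _).2 h0] at h2
    omega

/-- The derivation `(X_1 ∂_1 g) X_0 ∂_0 - (X_0 ∂_0 g) X_1 ∂_1`, tangent to the curve `g = 0`. -/
noncomputable def tangent (g : MvPolynomial (Fin 2) K) :
    Derivation K (MvPolynomial (Fin 2) K) (MvPolynomial (Fin 2) K) :=
  euler K 1 g • euler K 0 - euler K 0 g • euler K 1

theorem tangent_apply (g p : MvPolynomial (Fin 2) K) :
    tangent g p = euler K 1 g * euler K 0 p - euler K 0 g * euler K 1 p := rfl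

/-- The logarithmic derivative of `X_0 ^ a * X_1 ^ b` with respect to `tangent g`. -/
noncomputable def tangentLog (g : MvPolynomial (Fin 2) K) (a b : ℕ) : MvPolynomial (Fin 2) K :=
  MvPolynomial.C (a : K) * euler K 1 g - MvPolynomial.C (b : K) * euler K 0 g

theorem tangent_monomial (g : MvPolynomial (Fin 2) K) (a b : ℕ) :
    tangent g (MvPolynomial.X 0 ^ a * MvPolynomial.X 1 ^ b) =
      tangentLog g a b * (MvPolynomial.X 0 ^ a * MvPolynomial.X 1 ^ b) := by
  have h : ∀ i (n : ℕ), MvPolynomial.X (R := K) i * (n • (MvPolynomial.X i : MvPolynomial (Fin 2) K) ^ (n - 1)) =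
      MvPolynomial.C (n : K) * (MvPolynomial.X i : MvPolynomial (Fin 2) K) ^ n := fun i n => by
    cases n with
    | zero => simp
    | succ n => simp [pow_succ']; ring
  have h0 : euler K 0 (MvPolynomial.X 0 ^ a * MvPolynomial.X 1 ^ b) =
      MvPolynomial.C (a : K) * (MvPolynomial.X 0 ^ a * MvPolynomial.X 1 ^ b) := by
    have := h 0 a
    simp [euler_apply, Derivation.leibniz, Derivation.leibniz_pow] at this ⊢
    linear_combination MvPolynomial.X 1 ^ b * this
  have h1 : euler K 1 (MvPolynomial.X 0 ^ a * MvPolynomial.X 1 ^ b) =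
      MvPolynomial.C (b : K) * (MvPolynomial.X 0 ^ a * MvPolynomial.X 1 ^ b) := by
    have := h 1 b
    simp [euler_apply, Derivation.leibniz, Derivation.leibniz_pow] at this ⊢
    linear_combination MvPolynomial.X 0 ^ a * this
  rw [tangent_apply, h0, h1, tangentLog]
  ring

/-- The cofactor of `X_0 ^ a * X_1 ^ b` in its `i`-th derivative with respect to `tangent g`. -/
noncomputable def cofactor (g : MvPolynomial (Fin 2) K) (a b : ℕ) : ℕ → MvPolynomial (Fin 2) K
  | 0 => 1
  | i + 1 => tangent g (cofactor g a b i) + tangentLog g a b * cofactor g a b i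

theorem iterate_tangent_monomial (g : MvPolynomial (Fin 2) K) (a b i : ℕ) :
    (tangent g)^[i] (MvPolynomial.X 0 ^ a * MvPolynomial.X 1 ^ b) =
      cofactor g a b i * (MvPolynomial.X 0 ^ a * MvPolynomial.X 1 ^ b) := by
  induction i with
  | zero => simp [cofactor]
  | succ i ih =>
    rw [Function.iterate_succ_apply', ih, Derivation.leibniz, tangent_monomial, cofactor]
    simp only [smul_eq_mul]
    ring

theorem degreeOf_tangent_le (g p : MvPolynomial (Fin 2) K) (k : Fin 2) :
    (tangent g p).degreeOf k ≤ g.degreeOf k + p.degreeOf k := by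
  rw [tangent_apply]
  refine (MvPolynomial.degreeOf_sub_le _ _ _).trans (max_le ?_ ?_) <;>
  exact (MvPolynomial.degreeOf_mul_le _ _ _).trans
    (add_le_add (degreeOf_euler_le _ _ _) (degreeOf_euler_le _ _ _))

theorem degreeOf_tangentLog_le (g : MvPolynomial (Fin 2) K) (a b : ℕ) (k : Fin 2) :
    (tangentLog g a b).degreeOf k ≤ g.degreeOf k := by
  rw [tangentLog]
  refine (MvPolynomial.degreeOf_sub_le _ _ _).trans (max_le ?_ ?_) <;>
  exact (MvPolynomial.degreeOf_C_mul_le _ _ _).trans (degreeOf_euler_le _ _ _)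

theorem degreeOf_cofactor_le (g : MvPolynomial (Fin 2) K) (a b i : ℕ) (k : Fin 2) :
    (cofactor g a b i).degreeOf k ≤ i * g.degreeOf k := by
  induction i with
  | zero => simp [cofactor]
  | succ i ih =>
    rw [cofactor, add_mul, one_mul, add_comm (i * _)]
    refine (MvPolynomial.degreeOf_add_le _ _ _).trans (max_le ?_ ?_)
    · exact (degreeOf_tangent_le _ _ _).trans (add_le_add_right ih _)
    · exact (MvPolynomial.degreeOf_mul_le _ _ _).trans
        (add_le_add (degreeOf_tangentLog_le _ _ _ _) ih)

/-- Row `i` consists of `i`-th cofactors, each of degree at most `i` times that of `g`. -/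
theorem degreeOf_det_cofactor_le (g : MvPolynomial (Fin 2) K) {n : ℕ} (a b : Fin n → ℕ)
    (k : Fin 2) :
    (Matrix.of fun i j : Fin n => cofactor g (a j) (b j) i).det.degreeOf k ≤
      (∑ i ∈ Finset.range n, i) * g.degreeOf k := by
  rw [Matrix.det_apply]
  refine (MvPolynomial.degreeOf_sum_le _ _ _).trans (Finset.sup_le fun σ _ => ?_)
  have h : (∏ i, (Matrix.of fun i j : Fin n => cofactor g (a j) (b j) i) (σ i) i).degreeOf k ≤
      (∑ i ∈ Finset.range n, i) * g.degreeOf k := by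
    refine (MvPolynomial.degreeOf_prod_le _ _ _).trans ?_
    rw [← Fin.sum_univ_eq_sum_range (fun i => i) n, ← Equiv.sum_comp σ (fun i : Fin n => (i : ℕ)), Finset.sum_mul]
    exact Finset.sum_le_sum fun i _ => degreeOf_cofactor_le _ _ _ _ _
  rcases Int.units_eq_one_or (Equiv.Perm.sign σ) with hσ | hσ
  · simpa [hσ] using h
  · simpa [hσ] using h

end Bivariate
-- The derivation X d/dX on series
section EulerDerivation

variable {L : Type*} [Field L]

/-- The derivation `X d/dX` on series with rational exponents. -/
noncomputable def hahnEuler (L : Type*) [Field L] : HahnSeries ℚ L →+ HahnSeries ℚ L where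
  toFun x := ⟨fun q => (q : L) * x.coeff q, x.isPWO_support.mono fun q hq h => hq (by simp [h])⟩
  map_zero' := by ext q; simp
  map_add' x y := by ext q; simp [mul_add]

theorem coeff_hahnEuler (x : HahnSeries ℚ L) (q : ℚ) :
    (hahnEuler L x).coeff q = (q : L) * x.coeff q := rfl

theorem hahnEuler_mul [CharZero L] (x y : HahnSeries ℚ L) :
    hahnEuler L (x * y) = x * hahnEuler L y + y * hahnEuler L x := by
  have hx : (hahnEuler L x).support ⊆ x.support :=
    fun q hq h => hq (by simp [coeff_hahnEuler, h])
  have hy : (hahnEuler L y).support ⊆ y.support :=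
    fun q hq h => hq (by simp [coeff_hahnEuler, h])
  ext q
  change (q : L) * (x * y).coeff q = _
  rw [mul_comm y, HahnSeries.coeff_add, HahnSeries.coeff_mul_right' y.isPWO_support hy,
    HahnSeries.coeff_mul_left' x.isPWO_support hx, HahnSeries.coeff_mul,
    ← Finset.sum_add_distrib, Finset.mul_sum]
  refine Finset.sum_congr rfl fun ij hij => ?_
  have h : ij.1 + ij.2 = q := by simpa using (Finset.mem_antidiagonal.1 hij).2.2
  rw [← h]
  push_cast
  change _ = x.coeff ij.1 * (ij.2 * y.coeff ij.2) + ij.1 * x.coeff ij.1 * y.coeff ij.2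
  ring

theorem orderTop_le_orderTop_hahnEuler (x : HahnSeries ℚ L) :
    x.orderTop ≤ (hahnEuler L x).orderTop :=
  HahnSeries.le_orderTop_iff_forall.2 fun j hj => by
    rw [coeff_hahnEuler, HahnSeries.coeff_eq_zero_of_lt_orderTop hj, mul_zero]

theorem hahnEuler_single (q : ℚ) (a : L) :
    hahnEuler L (HahnSeries.single q a) = HahnSeries.single q (q * a) := by
  ext r
  rw [coeff_hahnEuler]
  by_cases h : r = q
  · rw [h, HahnSeries.coeff_single_same, HahnSeries.coeff_single_same]
  · rw [HahnSeries.coeff_single_of_ne h, HahnSeries.coeff_single_of_ne h, mul_zero]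

/-- The field of constants is L, so Wronskians detect linear dependence over L. -/
theorem eq_C_of_hahnEuler_eq_zero [CharZero L] {x : HahnSeries ℚ L} (h : hahnEuler L x = 0) :
    x = HahnSeries.C (x.coeff 0) := by
  ext q
  by_cases hq : q = 0
  · rw [hq, HahnSeries.C_apply, HahnSeries.coeff_single_same]
  · rw [HahnSeries.C_apply, HahnSeries.coeff_single_of_ne hq]
    have h1 := congrArg (fun y => HahnSeries.coeff y q) h
    rw [coeff_hahnEuler, HahnSeries.coeff_zero] at h1
    exact (mul_eq_zero.1 h1).resolve_left (by exact_mod_cast hq)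

end EulerDerivation

/-! ### Evaluation at (X, φ) and bounds for its valuation -/

section Evaluation

variable {K L : Type*} [Field K] [Field L] [Algebra K L]

/-- Evaluation of a bivariate polynomial at `(X, φ)`. -/
noncomputable def evalSeries (K : Type*) {L : Type*} [Field K] [Field L] [Algebra K L]
    (φ : HahnSeries ℚ L) : MvPolynomial (Fin 2) K →+* HahnSeries ℚ L :=
  MvPolynomial.eval₂Hom ((HahnSeries.C : L →+* HahnSeries ℚ L).comp (algebraMap K L))
    ![HahnSeries.single 1 1, φ]

variable (φ : HahnSeries ℚ L)

@[simp]
theorem evalSeries_C (a : K) :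
    evalSeries K φ (MvPolynomial.C a) = HahnSeries.C (algebraMap K L a) := by
  simp [evalSeries]

@[simp]
theorem evalSeries_X_zero : evalSeries K φ (MvPolynomial.X 0) = HahnSeries.single 1 1 := by
  simp [evalSeries]

@[simp]
theorem evalSeries_X_one : evalSeries K φ (MvPolynomial.X 1) = φ := by
  simp [evalSeries]

theorem evalSeries_aeval_X_zero (R : Polynomial K) :
    evalSeries K φ (R.aeval (MvPolynomial.X 0)) =
      ∑ i ∈ Finset.range (R.natDegree + 1), HahnSeries.single (i : ℚ) (algebraMap K L (R.coeff i)) := by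
  rw [Polynomial.aeval_eq_sum_range, map_sum]
  refine Finset.sum_congr rfl fun i _ => ?_
  rw [MvPolynomial.smul_eq_C_mul, map_mul, map_pow, evalSeries_C, evalSeries_X_zero,
    HahnSeries.single_pow, HahnSeries.C_apply,
    HahnSeries.single_mul_single]
  simp

theorem coeff_evalSeries_aeval_X_zero (R : Polynomial K) :
    (evalSeries K φ (R.aeval (MvPolynomial.X 0))).coeff (R.natDegree : ℚ) =
      algebraMap K L R.leadingCoeff := by
  rw [evalSeries_aeval_X_zero, HahnSeries.coeff_sum,
    Finset.sum_eq_single_of_mem R.natDegree (by simp), HahnSeries.coeff_single_same]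
  · rfl
  · intro i _ hi
    exact HahnSeries.coeff_single_of_ne (by exact_mod_cast hi.symm)

theorem orderTop_evalSeries_aeval_X_zero_le {R : Polynomial K} (hR : R ≠ 0) :
    (evalSeries K φ (R.aeval (MvPolynomial.X 0))).orderTop ≤ ((R.natDegree : ℚ) : WithTop ℚ) := by
  refine HahnSeries.orderTop_le_of_coeff_ne_zero ?_
  rw [coeff_evalSeries_aeval_X_zero]
  simpa using hR

theorem evalSeries_aeval_X_zero_ne_zero {R : Polynomial K} (hR : R ≠ 0) :
    evalSeries K φ (R.aeval (MvPolynomial.X 0)) ≠ 0 := fun h => by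
  have h1 := orderTop_evalSeries_aeval_X_zero_le φ hR
  rw [h, HahnSeries.orderTop_zero] at h1
  exact absurd h1 (by simp)

/-- If `g ∤ p`, elimination gives a nonzero polynomial in X alone in the ideal (g, p), and that
cannot vanish at (X, φ). -/
theorem evalSeries_eq_zero_iff {g : MvPolynomial (Fin 2) K} (hg : Irreducible g)
    (hd : 0 < g.degreeOf 1) (hφ : evalSeries K φ g = 0) (p : MvPolynomial (Fin 2) K) :
    evalSeries K φ p = 0 ↔ g ∣ p := by
  refine ⟨fun h => ?_, fun ⟨q, hq⟩ => by rw [hq, map_mul, hφ, zero_mul]⟩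
  by_contra hp
  obtain ⟨A, B, R, hR, -, -, hAB⟩ := exists_elimination hg hd hp
  refine evalSeries_aeval_X_zero_ne_zero φ hR ?_
  rw [← hAB, map_add, map_mul, map_mul, hφ, h, zero_mul, zero_mul, add_zero]

open Polynomial.Bivariate in
theorem evalSeries_eq_sum (p : MvPolynomial (Fin 2) K) :
    evalSeries K φ p = ∑ i ∈ Finset.range (p.degreeOf 1 + 1),
      evalSeries K φ ((((equivMvPolynomial K).symm p).coeff i).aeval (MvPolynomial.X 0)) * φ ^ i := by
  have h : (evalSeries K φ).comp (equivMvPolynomial K : _ →+* MvPolynomial (Fin 2) K) =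
      Polynomial.eval₂RingHom ((evalSeries K φ).comp
        (Polynomial.aeval (MvPolynomial.X 0) : Polynomial K →ₐ[K] MvPolynomial (Fin 2) K).toRingHom)
        φ := by
    ext a
    · simp [MvPolynomial.algebraMap_eq]
    · simp
    · simp
  have h1 := congrArg (fun e => e ((equivMvPolynomial K).symm p)) h
  simp only [RingHom.comp_apply, RingHom.coe_coe, AlgEquiv.apply_symm_apply,
    Polynomial.coe_eval₂RingHom] at h1
  rw [Polynomial.eval₂_eq_sum_range, natDegree_equivMvPolynomial_symm] at h1
  exact h1

theorem degreeOf_one_pos {g : MvPolynomial (Fin 2) K} (hg : Irreducible g)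
    (hφ : evalSeries K φ g = 0) : 0 < g.degreeOf 1 := by
  by_contra h0
  have h0 : g.degreeOf 1 = 0 := by omega
  have h1 := evalSeries_eq_sum φ g
  rw [hφ, h0, Finset.sum_range_one, pow_zero, mul_one] at h1
  refine evalSeries_aeval_X_zero_ne_zero φ (fun hz => ?_) h1.symm
  rw [← natDegree_equivMvPolynomial_symm, Polynomial.natDegree_eq_zero] at h0
  obtain ⟨c, hc⟩ := h0
  rw [← hc, Polynomial.coeff_C_zero] at hz
  rw [hz, Polynomial.C_0] at hc
  exact hg.ne_zero ((map_eq_zero_iff _ (AlgEquiv.injective _)).1 hc.symm)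

theorem not_dvd_X_one {g : MvPolynomial (Fin 2) K} (hφ : evalSeries K φ g = 0) (h0 : φ ≠ 0) :
    ¬ g ∣ MvPolynomial.X 1 := fun ⟨q, hq⟩ => h0 (by
  have h := congrArg (evalSeries K φ) hq
  rwa [evalSeries_X_one, map_mul, hφ, zero_mul] at h)

theorem zero_le_orderTop_evalSeries_aeval_X_zero (R : Polynomial K) :
    0 ≤ (evalSeries K φ (R.aeval (MvPolynomial.X 0))).orderTop := by
  rw [evalSeries_aeval_X_zero]
  refine (HahnSeries.addVal ℚ L).map_le_sum fun i _ => ?_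
  rw [HahnSeries.addVal_apply]
  refine le_trans ?_ HahnSeries.orderTop_single_le
  exact_mod_cast (Nat.cast_nonneg i : (0 : ℚ) ≤ i)

theorem orderTop_pow_eq {v : ℚ} (hv : φ.orderTop = v) (n : ℕ) :
    (φ ^ n).orderTop = ((n * v : ℚ) : WithTop ℚ) := by
  have h := (HahnSeries.addVal ℚ L).map_pow φ n
  rw [HahnSeries.addVal_apply, HahnSeries.addVal_apply, hv] at h
  rw [h, ← WithTop.coe_nsmul, nsmul_eq_mul]

theorem orderTop_mul_eq (x y : HahnSeries ℚ L) : (x * y).orderTop = x.orderTop + y.orderTop := by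
  simpa only [HahnSeries.addVal_apply] using (HahnSeries.addVal ℚ L).map_mul x y

/-- Coefficients in K[X] have nonnegative valuation, so negative contributions come only from powers
of φ, and only if v < 0. -/
theorem le_orderTop_evalSeries {v : ℚ} (hv : φ.orderTop = v) (p : MvPolynomial (Fin 2) K) :
    ((p.degreeOf 1 * min v 0 : ℚ) : WithTop ℚ) ≤ (evalSeries K φ p).orderTop := by
  rw [evalSeries_eq_sum]
  refine (HahnSeries.addVal ℚ L).map_le_sum fun i hi => ?_
  rw [HahnSeries.addVal_apply, orderTop_mul_eq, orderTop_pow_eq φ hv]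
  refine le_trans ?_ (add_le_add_left (zero_le_orderTop_evalSeries_aeval_X_zero φ _) _)
  rw [zero_add]
  refine WithTop.coe_le_coe.2 ?_
  have hi' : (i : ℚ) ≤ p.degreeOf 1 := by exact_mod_cast Nat.lt_succ_iff.1 (Finset.mem_range.1 hi)
  calc (p.degreeOf 1 : ℚ) * min v 0 ≤ i * min v 0 :=
        mul_le_mul_of_nonpos_right hi' (min_le_right _ _)
    _ ≤ i * v := mul_le_mul_of_nonneg_left (min_le_left _ _) (Nat.cast_nonneg i)

/-- The slopes of the Newton polygon of `g` are bounded by the degree in the first variable. -/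
theorem neg_degreeOf_zero_le {v : ℚ} (hv : φ.orderTop = v) {g : MvPolynomial (Fin 2) K}
    (hg : Irreducible g) (hφ : evalSeries K φ g = 0) : -(g.degreeOf 0 : ℚ) ≤ v := by
  -- Otherwise the term of top degree n+1 in Y has order at most deg_X g + (n+1)v < nv, strictly
  -- below the order of the sum of the other terms, and cannot cancel.
  by_contra! hlt
  have hd := degreeOf_one_pos φ hg hφ
  obtain ⟨n, hn⟩ : ∃ n, g.degreeOf 1 = n + 1 := ⟨_, (Nat.succ_pred_eq_of_pos hd).symm⟩
  have h1 := evalSeries_eq_sum φ g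
  rw [hφ, hn, Finset.sum_range_succ] at h1
  set G := (Polynomial.Bivariate.equivMvPolynomial K).symm g with hG
  have hlead : G.coeff (n + 1) ≠ 0 := by
    rw [← hn, hG, ← natDegree_equivMvPolynomial_symm]
    exact Polynomial.leadingCoeff_ne_zero.2
      fun h => hg.ne_zero ((map_eq_zero_iff _ (AlgEquiv.injective _)).1 h)
  set T := evalSeries K φ ((G.coeff (n + 1)).aeval (MvPolynomial.X 0)) * φ ^ (n + 1) with hT
  set S := ∑ i ∈ Finset.range (n + 1),
    evalSeries K φ ((G.coeff i).aeval (MvPolynomial.X 0)) * φ ^ i with hS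
  have hTle : T.orderTop ≤ ((g.degreeOf 0 + (n + 1) * v : ℚ) : WithTop ℚ) := by
    rw [hT, orderTop_mul_eq, orderTop_pow_eq φ hv, WithTop.coe_add]
    push_cast
    refine add_le_add_left ((orderTop_evalSeries_aeval_X_zero_le φ hlead).trans ?_) _
    refine WithTop.coe_le_coe.2 ?_
    exact_mod_cast natDegree_coeff_equivMvPolynomial_symm_le g (n + 1)
  have hSle : ((n * v : ℚ) : WithTop ℚ) ≤ S.orderTop := by
    refine (HahnSeries.addVal ℚ L).map_le_sum fun i hi => ?_
    rw [HahnSeries.addVal_apply, orderTop_mul_eq, orderTop_pow_eq φ hv]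
    refine le_trans ?_ (add_le_add_left (zero_le_orderTop_evalSeries_aeval_X_zero φ _) _)
    rw [zero_add]
    refine WithTop.coe_le_coe.2 (mul_le_mul_of_nonpos_right ?_ ?_)
    · exact_mod_cast Nat.lt_succ_iff.1 (Finset.mem_range.1 hi)
    · have : (0 : ℚ) ≤ g.degreeOf 0 := Nat.cast_nonneg _
      linarith
  have hST : S.orderTop = T.orderTop := by
    rw [eq_neg_of_add_eq_zero_left h1.symm, HahnSeries.orderTop_neg]
  have h2 := WithTop.coe_le_coe.1 (hSle.trans (hST.le.trans hTle))
  linarith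

/-- An upper bound for the valuation of `p(X, φ)` when it does not vanish. -/
theorem orderTop_evalSeries_le {v : ℚ} (hv : φ.orderTop = v) {g : MvPolynomial (Fin 2) K}
    (hg : Irreducible g) (hφ : evalSeries K φ g = 0) {dX dY : ℕ} (hX : g.degreeOf 0 ≤ dX)
    (hY : g.degreeOf 1 ≤ dY) {p : MvPolynomial (Fin 2) K} (hp : evalSeries K φ p ≠ 0) {N : ℕ}
    (hpX : p.degreeOf 0 ≤ N * dX) (hpY : p.degreeOf 1 ≤ N * dY) :
    (evalSeries K φ p).orderTop ≤ (((2 * N + 1) * (dX * dY) : ℚ) : WithTop ℚ) := by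
  have hd := degreeOf_one_pos φ hg hφ
  -- At (X, φ) the identity reads pA = R. Here R has order at most deg R ≤ 2N dX dY, and A has order
  -- at least -dX dY; together they give 2N+1.
  obtain ⟨A, B, R, hR, hRd, hA, hAB⟩ := exists_elimination hg hd
    fun h => hp ((evalSeries_eq_zero_iff φ hg hd hφ p).2 h)
  have hAle := le_orderTop_evalSeries φ hv A
  have hRle := orderTop_evalSeries_aeval_X_zero_le φ hR
  rw [← hAB, map_add, map_mul, map_mul, hφ, zero_mul, zero_add, orderTop_mul_eq] at hRle
  have h1 := (add_le_add_right hAle (evalSeries K φ p).orderTop).trans hRle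
  rw [← HahnSeries.order_eq_orderTop_of_ne_zero hp, ← WithTop.coe_add, WithTop.coe_le_coe] at h1
  rw [← HahnSeries.order_eq_orderTop_of_ne_zero hp, WithTop.coe_le_coe]
  have hvX := neg_degreeOf_zero_le φ hv hg hφ
  have hX' : (g.degreeOf 0 : ℚ) ≤ dX := by exact_mod_cast hX
  have hmin : -(dX : ℚ) ≤ min v 0 := le_min (by linarith) (by simp)
  have hAd : (A.degreeOf 1 : ℚ) ≤ dY := by exact_mod_cast hA.le.trans hY
  have h2 : -(dX * dY : ℚ) ≤ A.degreeOf 1 * min v 0 := by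
    have h3 : (A.degreeOf 1 : ℚ) * -dX ≤ A.degreeOf 1 * min v 0 :=
      mul_le_mul_of_nonneg_left hmin (Nat.cast_nonneg _)
    have h4 : (A.degreeOf 1 : ℚ) * dX ≤ dY * dX :=
      mul_le_mul_of_nonneg_right hAd (Nat.cast_nonneg _)
    linarith
  have h5 : R.natDegree ≤ dY * (N * dX) + N * dY * dX :=
    hRd.trans (add_le_add (Nat.mul_le_mul hY hpX) (Nat.mul_le_mul hpY hX))
  have h6 : (R.natDegree : ℚ) ≤ dY * (N * dX) + N * dY * dX := by exact_mod_cast h5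
  linarith

variable [CharZero L]

theorem hahnEuler_evalSeries (p : MvPolynomial (Fin 2) K) :
    hahnEuler L (evalSeries K φ p) = evalSeries K φ (euler K 0 p) +
      evalSeries K φ (MvPolynomial.pderiv 1 p) * hahnEuler L φ := by
  induction p using MvPolynomial.induction_on with
  | C a =>
    have h : hahnEuler L (HahnSeries.C (algebraMap K L a)) = 0 := by
      rw [HahnSeries.C_apply, hahnEuler_single, Rat.cast_zero, zero_mul, HahnSeries.single_eq_zero]
    rw [evalSeries_C, h]
    simp
  | add p q hp hq =>
    simp only [map_add, hp, hq]
    ring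
  | mul_X p i hp =>
    rw [map_mul, hahnEuler_mul, Derivation.leibniz, Derivation.leibniz, hp]
    fin_cases i
    · simp [euler_apply, hahnEuler_single]
      ring
    · simp [euler_apply]
      ring

/-- Differentiating g(X, φ) = 0 expresses the derivative of φ through the partial derivatives of g;
the factor Y∂_Y g clears the denominator. -/
theorem evalSeries_tangent {g : MvPolynomial (Fin 2) K} (hφ : evalSeries K φ g = 0)
    (p : MvPolynomial (Fin 2) K) :
    evalSeries K φ (tangent g p) =
      evalSeries K φ (euler K 1 g) * hahnEuler L (evalSeries K φ p) := by
  have h := hahnEuler_evalSeries φ g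
  rw [hφ, map_zero] at h
  rw [hahnEuler_evalSeries, tangent_apply, map_sub, map_mul, map_mul, euler_apply 1, euler_apply 1,
    map_mul, map_mul, evalSeries_X_one]
  linear_combination φ * evalSeries K φ (MvPolynomial.pderiv 1 p) * h

end Evaluation
-- The Wronskian of monomials in X and φ
section Wronskian

variable {K L : Type*} [Field K] [Field L] [Algebra K L] (φ : HahnSeries ℚ L)

theorem orderTop_evalSeries_monomial {v : ℚ} (hv : φ.orderTop = v) (a b : ℕ) :
    (evalSeries K φ (MvPolynomial.X 0 ^ a * MvPolynomial.X 1 ^ b)).orderTop =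
      ((a + v * b : ℚ) : WithTop ℚ) := by
  rw [map_mul, map_pow, map_pow, evalSeries_X_zero, evalSeries_X_one, orderTop_mul_eq,
    orderTop_pow_eq φ hv, HahnSeries.single_pow, one_pow, HahnSeries.orderTop_single one_ne_zero,
    ← WithTop.coe_add, nsmul_eq_mul, mul_one, mul_comm v]

/-- The derivation on series induced by `tangent g`. -/
noncomputable def seriesTangent (g : MvPolynomial (Fin 2) K) : HahnSeries ℚ L →+ HahnSeries ℚ L :=
  (AddMonoidHom.mulLeft (evalSeries K φ (euler K 1 g))).comp (hahnEuler L)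

theorem seriesTangent_apply (g : MvPolynomial (Fin 2) K) (x : HahnSeries ℚ L) :
    seriesTangent φ g x = evalSeries K φ (euler K 1 g) * hahnEuler L x := rfl

theorem iterate_seriesTangent_sum {ι : Type*} (g : MvPolynomial (Fin 2) K) (s : Finset ι)
    (d : ι → L) (x : ι → HahnSeries ℚ L) (i : ℕ) :
    (seriesTangent φ g)^[i] (∑ j ∈ s, d j • x j) =
      ∑ j ∈ s, d j • (seriesTangent φ g)^[i] (x j) := by
  induction i with
  | zero => rfl
  | succ i ih =>
    simp only [Function.iterate_succ_apply', ih, map_sum]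
    refine Finset.sum_congr rfl fun j _ => ?_
    have h : ∀ (c : L) (y : HahnSeries ℚ L), hahnEuler L (c • y) = c • hahnEuler L y := fun c y => by
      ext q
      simp [coeff_hahnEuler, mul_left_comm]
    rw [seriesTangent_apply, seriesTangent_apply, h, ← HahnSeries.C_mul_eq_smul,
      ← HahnSeries.C_mul_eq_smul, mul_left_comm]

theorem le_orderTop_iterate_seriesTangent (g : MvPolynomial (Fin 2) K) {e : ℚ}
    (he : (e : WithTop ℚ) ≤ (evalSeries K φ (euler K 1 g)).orderTop) (x : HahnSeries ℚ L) (i : ℕ) :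
    ((i * e : ℚ) : WithTop ℚ) + x.orderTop ≤ ((seriesTangent φ g)^[i] x).orderTop := by
  induction i with
  | zero => simp
  | succ i ih =>
    rw [Function.iterate_succ_apply', seriesTangent_apply, orderTop_mul_eq]
    refine le_trans (le_of_eq ?_)
      (add_le_add he (ih.trans (orderTop_le_orderTop_hahnEuler _)))
    rw [← add_assoc, ← WithTop.coe_add]
    congr 2
    push_cast
    ring

theorem evalSeries_termSum (c : ℕ → K) (α β : ℕ → ℕ) (m n : ℕ) :
    evalSeries K φ (termSum c α β m n) = ∑ j ∈ Finset.Icc m n, algebraMap K L (c j) •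
      evalSeries K φ (MvPolynomial.X 0 ^ α j * MvPolynomial.X 1 ^ β j) := by
  rw [termSum, map_sum]
  refine Finset.sum_congr rfl fun j _ => ?_
  rw [mul_assoc, map_mul, evalSeries_C, HahnSeries.C_mul_eq_smul]

variable [CharZero L]

theorem iterate_seriesTangent_evalSeries {g : MvPolynomial (Fin 2) K} (hφ : evalSeries K φ g = 0)
    (p : MvPolynomial (Fin 2) K) (i : ℕ) :
    (seriesTangent φ g)^[i] (evalSeries K φ p) = evalSeries K φ ((tangent g)^[i] p) := by
  induction i with
  | zero => rfl
  | succ i ih =>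
    rw [Function.iterate_succ_apply', Function.iterate_succ_apply', ih, seriesTangent_apply,
      evalSeries_tangent φ hφ]

/-- The scaling factor of the derivation is nonzero, so its constants are those of X d/dX, namely L.
-/
theorem wronskian_ne_zero {g : MvPolynomial (Fin 2) K}
    (hg : evalSeries K φ (euler K 1 g) ≠ 0) {n : ℕ} {x : Fin n → HahnSeries ℚ L}
    (hx : LinearIndependent L x) :
    (Matrix.of fun i j : Fin n => (seriesTangent φ g)^[i] (x j)).det ≠ 0 := by
  intro h
  obtain ⟨w, hw, hD, hs⟩ := exists_const_dependence_of_wronskian_eq_zero (seriesTangent φ g)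
    (fun x y => by rw [seriesTangent_apply, seriesTangent_apply, seriesTangent_apply,
      hahnEuler_mul]; ring) n x h
  have hC : ∀ j, w j = HahnSeries.C ((w j).coeff 0) := fun j =>
    eq_C_of_hahnEuler_eq_zero ((mul_eq_zero.1 (hD j)).resolve_left hg)
  refine hw (funext fun j => ?_)
  have h1 := Fintype.linearIndependent_iff.1 hx (fun j => (w j).coeff 0) (by
    rw [← hs]
    refine Finset.sum_congr rfl fun j _ => ?_
    rw [← HahnSeries.C_mul_eq_smul, ← hC]) j
  rw [hC, h1, map_zero, Pi.zero_apply]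

/-- Every entry of column `j` has the `j`-th monomial as a factor, which comes out of the
determinant. -/
theorem wronskian_monomial_eq {g : MvPolynomial (Fin 2) K} (hφ : evalSeries K φ g = 0) {n : ℕ}
    (a b : Fin n → ℕ) :
    (Matrix.of fun i j : Fin n => (seriesTangent φ g)^[i]
      (evalSeries K φ (MvPolynomial.X 0 ^ a j * MvPolynomial.X 1 ^ b j))).det =
    evalSeries K φ (MvPolynomial.X 0 ^ (∑ j, a j) * MvPolynomial.X 1 ^ (∑ j, b j)) *
      evalSeries K φ (Matrix.of fun i j : Fin n => cofactor g (a j) (b j) i).det := by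
  rw [RingHom.map_det, ← Finset.prod_pow_eq_pow_sum, ← Finset.prod_pow_eq_pow_sum,
    ← Finset.prod_mul_distrib, map_prod, ← Matrix.det_mul_row]
  congr 1
  ext1 i j
  simp only [Matrix.of_apply, RingHom.mapMatrix_apply, Matrix.map_apply]
  rw [iterate_seriesTangent_evalSeries φ hφ, iterate_tangent_monomial, map_mul, mul_comm]

/-- The valuation of a linear combination of `n` linearly independent monomials in `X` and `φ`. -/
theorem orderTop_sum_monomials_le [CharZero K] {v : ℚ} (hv : φ.orderTop = v)
    {g : MvPolynomial (Fin 2) K} (hg : Irreducible g) (hφ : evalSeries K φ g = 0) {dX dY : ℕ}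
    (hX : g.degreeOf 0 ≤ dX) (hY : g.degreeOf 1 ≤ dY) {n : ℕ} (a b : Fin n → ℕ) (d : Fin n → L)
    (hind : LinearIndependent L fun j =>
      evalSeries K φ (MvPolynomial.X 0 ^ a j * MvPolynomial.X 1 ^ b j))
    (j₀ : Fin n) (hd : d j₀ ≠ 0) :
    (∑ j, d j • evalSeries K φ (MvPolynomial.X 0 ^ a j * MvPolynomial.X 1 ^ b j)).orderTop ≤
      ((a j₀ + v * b j₀ + gap dX dY n : ℚ) : WithTop ℚ) := by
  set x : Fin n → HahnSeries ℚ L := fun j =>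
    evalSeries K φ (MvPolynomial.X 0 ^ a j * MvPolynomial.X 1 ^ b j) with hx
  change (∑ j, d j • x j).orderTop ≤ _
  have hxo : ∀ j, (x j).orderTop = ((a j + v * b j : ℚ) : WithTop ℚ) := fun j =>
    orderTop_evalSeries_monomial φ hv _ _
  have hCo : (HahnSeries.C (d j₀) : HahnSeries ℚ L).orderTop = 0 :=
    HahnSeries.orderTop_single hd
  obtain ⟨k, rfl⟩ : ∃ k, n = k + 1 := ⟨n - 1, by have := j₀.2; omega⟩
  -- A single monomial is treated directly: its gap is 0, while the Wronskian estimate would lose dX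
  -- dY.
  rcases Nat.eq_zero_or_pos k with rfl | hk
  · rw [Fin.sum_univ_one, ← Fin.eq_zero j₀, ← HahnSeries.C_mul_eq_smul, orderTop_mul_eq, hCo, hxo,
      zero_add]
    simp [gap]
  have hne : φ ≠ 0 := fun h => by simp [h] at hv
  have hdeg := degreeOf_one_pos φ hg hφ
  have hA : evalSeries K φ (euler K 1 g) ≠ 0 := fun h =>
    not_dvd_euler hg hdeg (not_dvd_X_one φ hφ hne) ((evalSeries_eq_zero_iff φ hg hdeg hφ _).1 h)
  set F := ∑ j, d j • x j with hF
  have hF0 : F ≠ 0 := fun h => hd (Fintype.linearIndependent_iff.1 hind d h j₀)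
  set N := ∑ i ∈ Finset.range (k + 1), i with hN
  set W := Matrix.of fun i j : Fin (k + 1) => (seriesTangent φ g)^[i] (x j) with hW
  have hW0 : W.det ≠ 0 := wronskian_ne_zero φ hA hind
  have hWeq := wronskian_monomial_eq φ hφ a b
  have hP0 : evalSeries K φ
      (Matrix.of fun i j : Fin (k + 1) => cofactor g (a j) (b j) i).det ≠ 0 := fun h =>
    hW0 (by rw [hW, hWeq, h, mul_zero])
  have hWle : W.det.orderTop ≤
      ((∑ j, (a j + v * b j) + (2 * N + 1) * (dX * dY) : ℚ) : WithTop ℚ) := by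
    rw [hW, hWeq, orderTop_mul_eq, orderTop_evalSeries_monomial φ hv,
      WithTop.coe_add (∑ j, (a j + v * b j) : ℚ)]
    refine add_le_add (le_of_eq (congrArg _ ?_))
      (orderTop_evalSeries_le φ hv hg hφ hX hY hP0 (N := N)
        ((degreeOf_det_cofactor_le _ _ _ _).trans (Nat.mul_le_mul le_rfl hX))
        ((degreeOf_det_cofactor_le _ _ _ _).trans (Nat.mul_le_mul le_rfl hY)))
    push_cast
    rw [Finset.sum_add_distrib, Finset.mul_sum]
  have hW' : (W.updateCol j₀ fun i => (seriesTangent φ g)^[i] F).det =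
      HahnSeries.C (d j₀) * W.det := by
    have h := Matrix.det_updateCol_sum W j₀ fun j => HahnSeries.C (d j)
    rw [smul_eq_mul] at h
    rw [← h]
    congr 2
    funext i
    rw [hF, iterate_seriesTangent_sum]
    simp only [hW, Matrix.of_apply, smul_eq_mul, HahnSeries.C_mul_eq_smul]
  have he : ((-(dX * dY) : ℚ) : WithTop ℚ) ≤ (evalSeries K φ (euler K 1 g)).orderTop := by
    refine le_trans (WithTop.coe_le_coe.2 ?_) (le_orderTop_evalSeries φ hv _)
    have hvX := neg_degreeOf_zero_le φ hv hg hφ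
    have hX' : (g.degreeOf 0 : ℚ) ≤ dX := by exact_mod_cast hX
    have hmin : -(dX : ℚ) ≤ min v 0 := le_min (by linarith) (by simp)
    have hAd : ((euler K 1 g).degreeOf 1 : ℚ) ≤ dY := by
      exact_mod_cast (degreeOf_euler_le 1 1 g).trans hY
    have h3 := mul_le_mul_of_nonneg_left hmin (Nat.cast_nonneg (α := ℚ) ((euler K 1 g).degreeOf 1))
    have h4 := mul_le_mul_of_nonneg_right hAd (Nat.cast_nonneg (α := ℚ) dX)
    linarith
  -- Row `i` has weight -i dX dY, as each derivation may lower the order by dX dY; column weights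
  -- are the orders of the monomials, with that of `F` in column `j₀`.
  have hlow := le_addValuation_det (HahnSeries.addVal ℚ L)
    (W.updateCol j₀ fun i => (seriesTangent φ g)^[i] F)
    (fun i => ((i * -(dX * dY) : ℚ) : WithTop ℚ))
    (fun j => ((Function.update (fun j => (a j + v * b j : ℚ)) j₀ F.order j : ℚ) : WithTop ℚ))
    (fun i j => by
      rw [HahnSeries.addVal_apply, Matrix.updateCol_apply]
      by_cases hj : j = j₀
      · rw [if_pos hj, hj, Function.update_self, HahnSeries.order_eq_orderTop_of_ne_zero hF0]
        exact le_orderTop_iterate_seriesTangent φ g he F i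
      · rw [if_neg hj, Function.update_of_ne hj, ← hxo]
        exact le_orderTop_iterate_seriesTangent φ g he (x j) i)
  rw [HahnSeries.addVal_apply, hW', orderTop_mul_eq, hCo, zero_add] at hlow
  have hfin := hlow.trans hWle
  rw [← WithTop.coe_sum, ← WithTop.coe_sum, ← WithTop.coe_add, WithTop.coe_le_coe,
    Finset.sum_update_of_mem (Finset.mem_univ _), Finset.sdiff_singleton_eq_erase,
    Finset.sum_erase_eq_sub (Finset.mem_univ _), ← Finset.sum_mul,
    Fin.sum_univ_eq_sum_range (fun i => (i : ℚ)), ← Nat.cast_sum, ← hN] at hfin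
  rw [← HahnSeries.order_eq_orderTop_of_ne_zero hF0, WithTop.coe_le_coe, gap]
  have hN2 : (N : ℚ) * 2 = (k + 1) * k := by
    exact_mod_cast Finset.sum_range_id_mul_two (k + 1)
  have hk' : (1 : ℚ) ≤ k := by exact_mod_cast hk
  -- 2N+1 comes from the upper bound and N from the row weights. With N = k(k+1)/2, equality holds
  -- at k = 1, which explains the constant 4 in the gap.
  have hcoef : (3 * N + 1 : ℚ) ≤ 4 * k ^ 2 := by nlinarith
  have hmul := mul_le_mul_of_nonneg_right hcoef (by positivity : (0 : ℚ) ≤ dX * dY)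
  push_cast
  linarith

end Wronskian

/-! ### The gap argument and multiplicities -/

section Gap

variable {K L : Type*} [Field K] [CharZero K] [Field L] [CharZero L] [Algebra K L]
  (φ : HahnSeries ℚ L)

theorem gap_add_le (dX dY : ℕ) {i m l : ℕ} (hi : 1 ≤ i) (hm : 1 ≤ m) (h : i + m ≤ l) :
    gap dX dY i + gap dX dY m ≤ gap dX dY l := by
  have hi' : (0 : ℚ) ≤ i - 1 := by
    have : (1 : ℚ) ≤ i := by exact_mod_cast hi
    linarith
  have hm' : (0 : ℚ) ≤ m - 1 := by
    have : (1 : ℚ) ≤ m := by exact_mod_cast hm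
    linarith
  have h' : (i + m : ℚ) ≤ l := by exact_mod_cast h
  have h1 : ((i : ℚ) - 1) ^ 2 + ((m : ℚ) - 1) ^ 2 ≤ ((l : ℚ) - 1) ^ 2 := by nlinarith
  have h2 := mul_le_mul_of_nonneg_left h1 (by positivity : (0 : ℚ) ≤ 4 * dX * dY)
  rw [gap, gap, gap]
  linarith

theorem gap_mono (dX dY : ℕ) {m l : ℕ} (hm : 1 ≤ m) (h : m ≤ l) :
    gap dX dY m ≤ gap dX dY l := by
  have hm' : (1 : ℚ) ≤ m := by exact_mod_cast hm
  have h' : (m : ℚ) ≤ l := by exact_mod_cast h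
  exact mul_le_mul_of_nonneg_left (pow_le_pow_left₀ (by linarith) (by linarith) 2) (by positivity)

theorem orderTop_evalSeries_termSum_le {v : ℚ} (hv : φ.orderTop = v)
    {g : MvPolynomial (Fin 2) K} (hg : Irreducible g) (hφ : evalSeries K φ g = 0) {dX dY : ℕ}
    (hX : g.degreeOf 0 ≤ dX) (hY : g.degreeOf 1 ≤ dY) {ℓ : ℕ} (c : ℕ → K) (α β : ℕ → ℕ)
    (hgap : ∀ j, 1 ≤ j → j < ℓ →
      (α (j + 1) : ℚ) + v * β (j + 1) ≤ α 1 + v * β 1 + gap dX dY j)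
    (h0 : evalSeries K φ (termSum c α β 1 ℓ) ≠ 0) :
    (evalSeries K φ (termSum c α β 1 ℓ)).orderTop ≤
      ((α 1 + v * β 1 + gap dX dY ℓ : ℚ) : WithTop ℚ) := by
  rw [evalSeries_termSum] at h0 ⊢
  obtain ⟨t, b, hts, hb, hind, hsum⟩ := exists_linearIndepOn_sum_eq (Finset.Icc 1 ℓ)
    (fun j => algebraMap K L (c j))
    (fun j => evalSeries K φ (MvPolynomial.X 0 ^ α j * MvPolynomial.X 1 ^ β j))
  rw [← hsum] at h0 ⊢
  have htne : t.Nonempty := by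
    by_contra h
    rw [Finset.not_nonempty_iff_eq_empty] at h
    exact h0 (by rw [h, Finset.sum_empty])
  set e := t.equivFin with he
  have hmin := t.min'_mem htne
  -- The monomial of least index in the independent subfamily is the one compared with. Its exponent
  -- is within γ(i₀ - 1) of the first if i₀ > 1, at most ℓ + 1 - i₀ monomials are in play, and
  -- superadditivity of γ absorbs both losses into γ(ℓ).
  set i₀ := t.min' htne with hi₀
  have hbd := orderTop_sum_monomials_le φ hv hg hφ hX hY (fun j => α (e.symm j))
    (fun j => β (e.symm j)) (fun j => b (e.symm j))
    ((LinearIndependent.comp hind _ e.symm.injective)) (e ⟨i₀, hmin⟩)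
    (by simpa using hb i₀ hmin)
  rw [Equiv.sum_comp e.symm fun j : t => b j •
    evalSeries K φ (MvPolynomial.X 0 ^ α j * MvPolynomial.X 1 ^ β j),
    Finset.sum_coe_sort t fun j => b j •
      evalSeries K φ (MvPolynomial.X 0 ^ α j * MvPolynomial.X 1 ^ β j),
    e.symm_apply_apply] at hbd
  refine hbd.trans (WithTop.coe_le_coe.2 ?_)
  have hi1 := Finset.mem_Icc.1 (hts hmin)
  have hcard : t.card ≤ ℓ + 1 - i₀ := by
    rw [← Nat.card_Icc]
    refine Finset.card_le_card fun j hj => Finset.mem_Icc.2 ⟨t.min'_le j hj, ?_⟩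
    exact (Finset.mem_Icc.1 (hts hj)).2
  have hpos : 1 ≤ t.card := htne.card_pos
  change (α i₀ : ℚ) + v * β i₀ + gap dX dY t.card ≤ _
  obtain ⟨i, hi⟩ : ∃ i, i₀ = i + 1 := ⟨i₀ - 1, by omega⟩
  rcases Nat.eq_zero_or_pos i with hz | hi'
  · rw [hi, hz, zero_add]
    linarith [gap_mono dX dY hpos (show t.card ≤ ℓ by omega)]
  · rw [hi]
    linarith [hgap i hi' (by omega), gap_add_le dX dY hi' hpos (show i + t.card ≤ ℓ by omega)]

/-- If the exponents of the second part are far away, then a common root annihilates the first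
part. -/
theorem dvd_left_of_dvd_add {v : ℚ} (hv : φ.orderTop = v)
    {g : MvPolynomial (Fin 2) K} (hg : Irreducible g) (hφ : evalSeries K φ g = 0) {dX dY : ℕ}
    (hX : g.degreeOf 0 ≤ dX) (hY : g.degreeOf 1 ≤ dY) {k ℓ : ℕ} (c : ℕ → K) (α β : ℕ → ℕ)
    (hgap : ∀ j, 1 ≤ j → j < ℓ →
      (α (j + 1) : ℚ) + v * β (j + 1) ≤ α 1 + v * β 1 + gap dX dY j)
    (hfar : ∀ j ∈ Finset.Icc (ℓ + 1) k,
      (α 1 : ℚ) + v * β 1 + gap dX dY ℓ < α j + v * β j)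
    (h : g ∣ termSum c α β 1 ℓ + termSum c α β (ℓ + 1) k) : g ∣ termSum c α β 1 ℓ := by
  have hdeg := degreeOf_one_pos φ hg hφ
  rw [← evalSeries_eq_zero_iff φ hg hdeg hφ] at h ⊢
  by_contra h0
  have h1 := orderTop_evalSeries_termSum_le φ hv hg hφ hX hY c α β hgap h0
  rw [map_add] at h
  have h2 : ((α 1 + v * β 1 + gap dX dY ℓ : ℚ) : WithTop ℚ) <
      (evalSeries K φ (termSum c α β (ℓ + 1) k)).orderTop := by
    rw [evalSeries_termSum]
    refine (HahnSeries.addVal ℚ L).map_lt_sum (WithTop.coe_ne_top) fun j hj => ?_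
    rw [HahnSeries.addVal_apply, ← HahnSeries.C_mul_eq_smul, orderTop_mul_eq,
      orderTop_evalSeries_monomial φ hv]
    refine lt_of_lt_of_le (WithTop.coe_lt_coe.2 (hfar j hj)) (le_add_of_nonneg_left ?_)
    exact HahnSeries.orderTop_single_le
  rw [eq_neg_of_add_eq_zero_left h, HahnSeries.orderTop_neg] at h1
  exact absurd (h2.trans_le h1) (lt_irrefl _)

theorem euler_one_termSum (c : ℕ → K) (α β : ℕ → ℕ) (m n : ℕ) :
    euler K 1 (termSum c α β m n) = termSum (fun j => c j * β j) α β m n := by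
  rw [termSum, termSum, map_sum]
  refine Finset.sum_congr rfl fun j _ => ?_
  rw [euler_apply]
  cases hβ : β j with
  | zero => simp [Derivation.leibniz, Derivation.leibniz_pow]
  | succ n =>
    simp [Derivation.leibniz, Derivation.leibniz_pow]
    ring

/-- The gap conditions involve only exponents, so the induction runs over all coefficient families
and may be applied to both f and Y∂_Y f. -/
theorem pow_dvd_left_of_pow_dvd_add {v : ℚ} (hv : φ.orderTop = v)
    {g : MvPolynomial (Fin 2) K} (hg : Irreducible g) (hφ : evalSeries K φ g = 0) {dX dY : ℕ}
    (hX : g.degreeOf 0 ≤ dX) (hY : g.degreeOf 1 ≤ dY) {k ℓ : ℕ} (α β : ℕ → ℕ)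
    (hgap : ∀ j, 1 ≤ j → j < ℓ →
      (α (j + 1) : ℚ) + v * β (j + 1) ≤ α 1 + v * β 1 + gap dX dY j)
    (hfar : ∀ j ∈ Finset.Icc (ℓ + 1) k,
      (α 1 : ℚ) + v * β 1 + gap dX dY ℓ < α j + v * β j)
    (n : ℕ) (c : ℕ → K) (h : g ^ n ∣ termSum c α β 1 ℓ + termSum c α β (ℓ + 1) k) :
    g ^ n ∣ termSum c α β 1 ℓ := by
  induction n generalizing c with
  | zero => simp
  | succ n ih =>
    -- The first power is separate: below, the factor `n` produced by differentiating `g ^ n` must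
    -- be a unit.
    rcases Nat.eq_zero_or_pos n with rfl | hn
    · rw [zero_add, pow_one] at h ⊢
      exact dvd_left_of_dvd_add φ hv hg hφ hX hY c α β hgap hfar h
    have hleib : ∀ q, euler K 1 (g ^ n * q) =
        g ^ n * euler K 1 q + g ^ (n - 1) * ((n : MvPolynomial (Fin 2) K) * euler K 1 g * q) :=
      fun q => by
        rw [Derivation.leibniz, Derivation.leibniz_pow]
        simp only [smul_eq_mul, nsmul_eq_mul]
        ring
    have hpow : g ^ n = g ^ (n - 1) * g := by rw [← pow_succ, Nat.sub_add_cancel hn]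
    have h1 : g ^ n ∣ euler K 1 (termSum c α β 1 ℓ + termSum c α β (ℓ + 1) k) := by
      obtain ⟨q, hq⟩ := h
      rw [hq, pow_succ, mul_assoc, hleib]
      refine dvd_add (dvd_mul_right _ _) ⟨(n : MvPolynomial (Fin 2) K) * euler K 1 g * q, ?_⟩
      rw [hpow]
      ring
    rw [map_add, euler_one_termSum, euler_one_termSum] at h1
    have h2 := ih _ h1
    rw [← euler_one_termSum] at h2
    -- With f₁ = gⁿq, divisibility of Y∂_Y f₁ by gⁿ forces g ∣ n(Y∂_Y g)q, hence g ∣ q.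
    obtain ⟨q, hq⟩ := ih c ((pow_dvd_pow g n.le_succ).trans h)
    rw [hq, hleib] at h2
    have h4 := (dvd_add_right (dvd_mul_right _ _)).1 h2
    rw [hpow, mul_dvd_mul_iff_left (pow_ne_zero _ hg.ne_zero)] at h4
    have hne : φ ≠ 0 := fun h => by simp [h] at hv
    have hunit : IsUnit (n : MvPolynomial (Fin 2) K) := by
      rw [← map_natCast (MvPolynomial.C : K →+* MvPolynomial (Fin 2) K)]
      exact (IsUnit.mk0 _ (by exact_mod_cast hn.ne')).map _
    have h5 : g ∣ q := by
      rcases hg.prime.dvd_or_dvd h4 with h5 | h5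
      · rw [hunit.dvd_mul_left] at h5
        exact absurd h5 (not_dvd_euler hg (degreeOf_one_pos φ hg hφ) (not_dvd_X_one φ hφ hne))
      · exact h5
    rw [hq, pow_succ]
    exact mul_dvd_mul_left _ h5

end Gap
end LacunaryGap

theorem mainTheorem1 {K : Type*} [Field K] [CharZero K]
    {L : Type*} [Field L] [Algebra K L] [IsAlgClosure K L]
    (v : ℚ) (dX dY k ℓ : ℕ) (c : ℕ → K) (α β : ℕ → ℕ)
    (f f₁ f₂ : MvPolynomial (Fin 2) K)
    (hf : f = f₁ + f₂)
    (hf₁ : f₁ = LacunaryGap.termSum c α β 1 ℓ)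
    (hf₂ : f₂ = LacunaryGap.termSum c α β (ℓ + 1) k)
    (hsorted : ∀ j : ℕ, 1 ≤ j → j < k →
      (α j : ℚ) + v * β j ≤ (α (j + 1) : ℚ) + v * β (j + 1))
    (hℓ : IsLeast {j : ℕ | 1 ≤ j ∧ j < k ∧
      (α 1 : ℚ) + v * β 1 + LacunaryGap.gap dX dY j < (α (j + 1) : ℚ) + v * β (j + 1)} ℓ)
    (g : MvPolynomial (Fin 2) K) (hg : Irreducible g)
    (hdeg : LacunaryGap.BidegreeLE g dX dY)
    (hroot : LacunaryGap.HasPuiseuxRoot L g v) :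
    emultiplicity g f = min (emultiplicity g f₁) (emultiplicity g f₂) := by
  have : CharZero L := charZero_of_injective_algebraMap (algebraMap K L).injective
  obtain ⟨⟨hℓ1, hℓk, hℓgap⟩, hleast⟩ := hℓ
  obtain ⟨φ, hφ0, hφv, hφ⟩ := hroot
  have hne : (φ : HahnSeries ℚ L) ≠ 0 := fun h => hφ0 (Subtype.ext h)
  have hv : (φ : HahnSeries ℚ L).orderTop = v := by
    rw [← HahnSeries.order_eq_orderTop_of_ne_zero hne]
    exact congrArg _ hφv
  have hev : LacunaryGap.evalSeries K (φ : HahnSeries ℚ L) g = 0 := by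
    have h := congrArg (LacunaryGap.PuiseuxSeries L).subtype hφ
    rw [map_zero, MvPolynomial.hom_eval₂] at h
    rw [← h, LacunaryGap.evalSeries, MvPolynomial.coe_eval₂Hom]
    congr 1
    funext i
    fin_cases i <;> rfl
  have hgap : ∀ j, 1 ≤ j → j < ℓ →
      (α (j + 1) : ℚ) + v * β (j + 1) ≤ α 1 + v * β 1 + LacunaryGap.gap dX dY j :=
    fun j hj1 hj => by
      by_contra! h
      exact absurd (hleast ⟨hj1, hj.trans hℓk, h⟩) (by omega)
  have hfar : ∀ j ∈ Finset.Icc (ℓ + 1) k,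
      (α 1 : ℚ) + v * β 1 + LacunaryGap.gap dX dY ℓ < α j + v * β j := fun j hj => by
    obtain ⟨h1, h2⟩ := Finset.mem_Icc.1 hj
    induction j, h1 using Nat.le_induction with
    | base => exact hℓgap
    | succ j hj' ih =>
      exact (ih (Finset.mem_Icc.2 ⟨hj', by omega⟩) (by omega)).trans_le
        (hsorted j (by omega) (by omega))
  subst hf hf₁ hf₂
  refine le_antisymm ?_ min_le_emultiplicity_add
  -- Testing against finite powers also covers f = 0, where the multiplicity is `⊤`.
  refine ENat.forall_natCast_le_iff_le.1 fun n hn => ?_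
  rw [← pow_dvd_iff_le_emultiplicity] at hn
  have h1 := LacunaryGap.pow_dvd_left_of_pow_dvd_add _ hv hg hev hdeg.1 hdeg.2 α β hgap hfar n c hn
  rw [le_min_iff, ← pow_dvd_iff_le_emultiplicity, ← pow_dvd_iff_le_emultiplicity]
  exact ⟨h1, (dvd_add_right h1).1 hn⟩
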